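/- Let $F$ be a field and let $R_F=\mathbb{Z}[F^\times/(F^\times)^2]$. For $x\in F^\times$ write $\langle x\rangle\in R_F$ for its square class and $\langle\langle x\rangle\rangle=\langle x\rangle-1$. Let $RP(F)$ denote the refined pre-Bloch group of $F$. If $|F|\ge 4$ it is the $R_F$-module with generators $[x]$, $x\in F^\times$, and relations $[1]=0$ and \[ [x]-[y]+\langle x\rangle\left[\frac{y}{x}\right]-\langle x^{-1}-1\rangle\left[\frac{1-x^{-1}}{1-y^{-1}}\right]+\langle 1-x\rangle\left[\frac{1-x}{1-y}\right]=0\qquad (x,y\in F^\times\setminus\{1\}). \] If $|F|=3$ it is the cyclic $R_F$-module generated by $[-1]$ with the single relation $2([-1]+\langle -1\rangle[-1])=0$, and we put $[1]=0$. If $|F|=2$ it is a group of order $3$ with a distinguished generator $\beta_F$, and we put $[1]=0$. For $x\in F^\times$ let \[ \psi_1(x)=[x]+\langle -1\rangle[x^{-1}],\qquad \psi_2(x)=\begin{cases}\langle 1-x\rangle\left(\langle x\rangle[x]+[x^{-1}]\right),& x\neq 1,\\ 0,& x=1.\end{cases} \] If $|F|\ge 4$, the element \[ C(x)=[x]+\langle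 -1\rangle[1-x]+\langle\langle 1-x\rangle\rangle\psi_1(x)\in RP(F) \] does not depend on $x\in F\setminus\{0,1\}$, and $\beta_F$ denotes this common value. If $|F|=3$ let $\beta_F=\psi_1(-1)$. Put $D_F=2\beta_F$. \textbf{Theorem.} Let $F$ be a field. \begin{enumerate} \item For all $x\in F^\times$, $\langle\langle x\rangle\rangle D_F=\psi_1(x)-\psi_2(x)$ in $RP(F)$. \item Let $E=F(\zeta_3)$ be the splitting field of $T^2+T+1$ over $F$. If $x\in F^\times$ and $x$ or $-x$ lies in $N_{E/F}(E^\times)$, then $\langle\langle x\rangle\rangle D_F=0$. \end{enumerate} -/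

import Mathlib

namespace RefinedBloch

noncomputable section

/-- The group of square classes `Fˣ / (Fˣ)²`. -/
def SqClass (F : Type*) [Field F] : Type _ :=
  Fˣ ⧸ (powMonoidHom 2 : Fˣ →* Fˣ).range

instance (F : Type*) [Field F] : CommGroup (SqClass F) :=
  inferInstanceAs (CommGroup (Fˣ ⧸ (powMonoidHom 2 : Fˣ →* Fˣ).range))

/-- The projection from units to square classes. -/
def toSqClass (F : Type*) [Field F] : Fˣ →* SqClass F :=
  QuotientGroup.mk' (powMonoidHom 2 : Fˣ →* Fˣ).range

/-- The integral group ring `R_F = ℤ[Fˣ / (Fˣ)²]`. -/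
def SqRing (F : Type*) [Field F] : Type _ :=
  MonoidAlgebra ℤ (SqClass F)

instance (F : Type*) [Field F] : CommRing (SqRing F) :=
  inferInstanceAs (CommRing (MonoidAlgebra ℤ (SqClass F)))

/-- The inclusion of the square classes into the group ring. -/
def ofSqClass (F : Type*) [Field F] : SqClass F →* SqRing F :=
  MonoidAlgebra.of ℤ (SqClass F)

variable {F : Type*} [Field F]

/-- The class `⟨x⟩` of a unit `x` in the group ring. -/
def sq (x : Fˣ) : SqRing F :=
  ofSqClass F (toSqClass F x)

/-- The element `⟨⟨x⟩⟩ = ⟨x⟩ - 1` of the augmentation ideal. -/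
def pf (x : Fˣ) : SqRing F := sq x - 1

/-- The unit `1 - x`, for a unit `x ≠ 1`. -/
def oneSub (x : Fˣ) (hx : x ≠ 1) : Fˣ :=
  Units.mk0 (1 - (x : F)) (sub_ne_zero.mpr fun h => hx (Units.ext h.symm))

/-- The unit `x - 1`, for a unit `x ≠ 1`. -/
def subOne (x : Fˣ) (hx : x ≠ 1) : Fˣ :=
  Units.mk0 ((x : F) - 1) (sub_ne_zero.mpr fun h => hx (Units.ext h))

/-- Generators of the refined pre-Bloch group: one symbol for every unit and, exactly when `F` has
two elements, one further symbol (the distinguished generator). -/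
abbrev Gen (F : Type*) [Field F] : Type _ := Fˣ ⊕ PLift (Nat.card F = 2)

/-- The free `R_F`-module on the generators. -/
abbrev FreeRP (F : Type*) [Field F] : Type _ := Gen F →₀ SqRing F

/-- The free symbol `[x]`. -/
def sym (x : Fˣ) : FreeRP F := Finsupp.single (Sum.inl x) 1

/-- The defining relations of the refined pre-Bloch group. Only `one` and `five` concern fields with
at least four elements. If `F` has two elements, `five` is void, and the quotient is the group of
order three generated by the extra symbol. If `F` has three elements, `one` and `five` only say
`[1] = 0`, and the quotient is the cyclic module on `[-1]` with the single relation `three`. -/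
inductive Rel (F : Type*) [Field F] : FreeRP F → Prop
  | one : Rel F (sym 1)
  | five (x y : Fˣ) (hx : x ≠ 1) (hy : y ≠ 1) :
      Rel F (sym x - sym y + sq x • sym (y / x)
        - sq (subOne x⁻¹ (inv_ne_one.mpr hx)) •
            sym (oneSub x⁻¹ (inv_ne_one.mpr hx) / oneSub y⁻¹ (inv_ne_one.mpr hy))
        + sq (oneSub x hx) • sym (oneSub x hx / oneSub y hy))
  | two (h : Nat.card F = 2) :
      Rel F ((3 : ℕ) • (Finsupp.single (Sum.inr ⟨h⟩) 1 : FreeRP F))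
  | three (h : Nat.card F = 3) :
      Rel F ((2 : ℕ) • (sym (-1 : Fˣ) + sq (-1 : Fˣ) • sym (-1 : Fˣ)))

/-- The submodule of relations. -/
def relSub (F : Type*) [Field F] : Submodule (SqRing F) (FreeRP F) :=
  Submodule.span (SqRing F) {r : FreeRP F | Rel F r}

/-- The refined pre-Bloch group `RP(F)`, an `R_F`-module. -/
abbrev RP (F : Type*) [Field F] : Type _ := FreeRP F ⧸ relSub F

/-- The symbol `[x]` in `RP(F)`. -/
def gpb (x : Fˣ) : RP F := (relSub F).mkQ (sym x)

/-- The element `ψ₁(x) = [x] + ⟨-1⟩[x⁻¹]`. -/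
def psi1 (x : Fˣ) : RP F := gpb x + sq (-1 : Fˣ) • gpb x⁻¹

open Classical in
/-- The element `ψ₂(x) = ⟨1 - x⟩(⟨x⟩[x] + [x⁻¹])` for `x ≠ 1`, and `ψ₂(1) = 0`. -/
def psi2 (x : Fˣ) : RP F :=
  if hx : x = 1 then 0 else sq (oneSub x hx) • (sq x • gpb x + gpb x⁻¹)

/-- The element `C(x) = [x] + ⟨-1⟩[1 - x] + ⟨⟨1 - x⟩⟩ψ₁(x)` for `x ≠ 1`. -/
def constC (x : Fˣ) (hx : x ≠ 1) : RP F :=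
  gpb x + sq (-1 : Fˣ) • gpb (oneSub x hx) + pf (oneSub x hx) • psi1 x

theorem exists_unit_ne_one (h : Nat.card F ≠ 2) : ∃ x : Fˣ, x ≠ 1 := by
  by_contra! hc
  apply h
  have : (Set.univ : Set F) = {0, 1} := by
    ext a
    simp only [Set.mem_univ, Set.mem_insert_iff, Set.mem_singleton_iff, true_iff]
    by_cases ha : a = 0
    · exact Or.inl ha
    · exact Or.inr (by simpa using congrArg Units.val (hc (Units.mk0 a ha)))
  rw [← Set.ncard_univ, this, Set.ncard_pair zero_ne_one]

open Classical in
/-- The constant `β_F`: the distinguished generator of `RP(F)` if `F` has two elements, `ψ₁(-1)` if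
`F` has three elements, and otherwise the common value of all `C(x)`, `x ≠ 0, 1`; see
`bconst_eq_constC` for the independence of `x`. -/
def bconst (F : Type*) [Field F] : RP F :=
  if h2 : Nat.card F = 2 then (relSub F).mkQ (Finsupp.single (Sum.inr ⟨h2⟩) 1 : FreeRP F)
  else if Nat.card F = 3 then psi1 (-1)
  else constC (exists_unit_ne_one h2).choose (exists_unit_ne_one h2).choose_spec

/-- The constant `D_F = 2β_F`. -/
def dconst (F : Type*) [Field F] : RP F := (2 : ℕ) • bconst F

/-! Independence of `C(x)` from `x`. -/

theorem sq_mul (x y : Fˣ) : sq (x * y) = sq x * sq y := by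
  simp [sq]

theorem sq_one : sq (1 : Fˣ) = 1 := by
  simp [sq]

theorem sq_mul_self (x : Fˣ) : sq x * sq x = 1 := by
  rw [← sq_mul, ← sq_one]
  unfold sq
  congr 1
  rw [map_one]
  exact (QuotientGroup.eq_one_iff _).mpr ⟨x, by simp [pow_two]⟩

theorem sq_inv (x : Fˣ) : sq x⁻¹ = sq x := by
  have h : sq x * sq x⁻¹ = 1 := by rw [← sq_mul, mul_inv_cancel, sq_one]
  calc sq x⁻¹ = (sq x * sq x) * sq x⁻¹ := by rw [sq_mul_self, one_mul]
    _ = sq x := by rw [mul_assoc, h, mul_one]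

theorem gpb_one : gpb (1 : Fˣ) = 0 :=
  (Submodule.Quotient.mk_eq_zero _).mpr (Submodule.subset_span Rel.one)

theorem five_term (x y : Fˣ) (hx : x ≠ 1) (hy : y ≠ 1) :
    gpb x - gpb y + sq x • gpb (y / x)
      - sq (subOne x⁻¹ (inv_ne_one.mpr hx)) •
          gpb (oneSub x⁻¹ (inv_ne_one.mpr hx) / oneSub y⁻¹ (inv_ne_one.mpr hy))
      + sq (oneSub x hx) • gpb (oneSub x hx / oneSub y hy) = 0 := by
  have h := (Submodule.Quotient.mk_eq_zero (relSub F)).mpr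
    (Submodule.subset_span (Rel.five x y hx hy))
  simpa [gpb] using h

theorem subOne_inv (x : Fˣ) (hx : x ≠ 1) :
    subOne x⁻¹ (inv_ne_one.mpr hx) = oneSub x hx * x⁻¹ := by
  ext
  simp [subOne, oneSub, sub_mul]

theorem oneSub_inv (x : Fˣ) (hx : x ≠ 1) :
    oneSub x⁻¹ (inv_ne_one.mpr hx) = -1 * (oneSub x hx * x⁻¹) := by
  ext
  simp [oneSub, sub_mul]

theorem oneSub_ne_one (x : Fˣ) (hx : x ≠ 1) : oneSub x hx ≠ 1 := by
  intro h
  have := congrArg Units.val h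
  simp [oneSub] at this

theorem oneSub_oneSub (x : Fˣ) (hx : x ≠ 1) : oneSub (oneSub x hx) (oneSub_ne_one x hx) = x := by
  ext
  simp [oneSub]

/-- The five term relation with `u = 1 - x` and `v = 1 - y`. -/
theorem five_term' (x y : Fˣ) (hx : x ≠ 1) (hy : y ≠ 1) :
    gpb x - gpb y + sq x • gpb (y * x⁻¹)
      - (sq (oneSub x hx) * sq x) • gpb (oneSub x hx * x⁻¹ * (oneSub y hy)⁻¹ * y)
      + sq (oneSub x hx) • gpb (oneSub x hx * (oneSub y hy)⁻¹) = 0 := by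
  have h := five_term x y hx hy
  have e : -1 * (oneSub x hx * x⁻¹) / (-1 * (oneSub y hy * y⁻¹))
      = oneSub x hx * x⁻¹ * (oneSub y hy)⁻¹ * y := by
    rw [mul_div_mul_left_eq_div, div_eq_mul_inv, mul_inv, inv_inv, mul_assoc, mul_assoc, mul_assoc]
  rwa [subOne_inv x hx, oneSub_inv x hx, oneSub_inv y hy, e, sq_mul, sq_inv, div_eq_mul_inv, div_eq_mul_inv] at h

theorem psi1_one : psi1 (1 : Fˣ) = 0 := by
  simp [psi1, gpb_one]

theorem psi1_mul_aux (x z : Fˣ) (hx : x ≠ 1) (hz : z ≠ 1) :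
    psi1 z = psi1 x + sq x • psi1 (z * x⁻¹) := by
  have h1 := five_term' x z hx hz
  have h2 := five_term' x⁻¹ z⁻¹ (inv_ne_one.mpr hx) (inv_ne_one.mpr hz)
  set u := oneSub x hx with hu
  set w := oneSub z hz with hw
  have e1 : -1 * (u * x⁻¹) * (x⁻¹)⁻¹ * (-1 * (w * z⁻¹))⁻¹ * z⁻¹ = u * w⁻¹ := by
    ext
    push_cast
    field_simp
  have e2 : -1 * (u * x⁻¹) * (-1 * (w * z⁻¹))⁻¹ = u * x⁻¹ * w⁻¹ * z := by
    ext
    push_cast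
    field_simp
  rw [oneSub_inv x hx, oneSub_inv z hz, ← hu, ← hw, e1, e2] at h2
  simp only [sq_mul, sq_inv] at h2
  have e3 : (z * x⁻¹)⁻¹ = z⁻¹ * x⁻¹⁻¹ := by rw [mul_inv]
  have m1 := sq_mul_self (-1 : Fˣ)
  have mx := sq_mul_self x
  have h3 := congrArg (fun t => sq (-1 : Fˣ) • t) h2
  simp only [smul_add, smul_sub, smul_smul, smul_zero] at h3
  have c1 : sq (-1 : Fˣ) * (sq (-1 : Fˣ) * (sq u * sq x) * sq x) = sq u := by
    linear_combination (sq u * sq x * sq x) * m1 + sq u * mx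
  have c2 : sq (-1 : Fˣ) * (sq (-1 : Fˣ) * (sq u * sq x)) = sq u * sq x := by
    linear_combination (sq u * sq x) * m1
  rw [c1, c2] at h3
  have h4 := congrArg₂ (· + ·) h1 h3
  simp only [add_zero] at h4
  simp only [psi1, e3, smul_add, smul_smul]
  rw [← sub_eq_zero, ← neg_eq_zero, ← h4, mul_comm (sq x) (sq (-1 : Fˣ))]
  abel

theorem exists_third (h3 : Nat.card F ≠ 3) (a : Fˣ) (ha : a ≠ 1) :
    ∃ y : Fˣ, y ≠ 1 ∧ y ≠ a := by
  by_contra! hc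
  apply h3
  have hset : (Set.univ : Set F) = {0, 1, (a : F)} := by
    ext b
    simp only [Set.mem_univ, Set.mem_insert_iff, Set.mem_singleton_iff, true_iff]
    by_cases hb : b = 0
    · exact Or.inl hb
    by_cases hb1 : b = 1
    · exact Or.inr (Or.inl hb1)
    refine Or.inr (Or.inr ?_)
    have := hc (Units.mk0 b hb) (fun h => hb1 (by simpa using congrArg Units.val h))
    simpa using congrArg Units.val this
  rw [← Set.ncard_univ, hset, Set.ncard_eq_three]
  exact ⟨0, 1, a, zero_ne_one, a.ne_zero.symm, fun h => ha (Units.ext h.symm), rfl⟩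

/-- The cocycle identity for `ψ₁`. -/
theorem psi1_mul (h2 : Nat.card F ≠ 2) (h3 : Nat.card F ≠ 3) (x y : Fˣ) :
    psi1 (x * y) = psi1 x + sq x • psi1 y := by
  by_cases hx : x = 1
  · simp [hx, psi1_one, sq_one]
  by_cases hxy : x * y = 1
  · obtain ⟨y', hy1, hy2⟩ := exists_third h3 x⁻¹ (inv_ne_one.mpr hx)
    have hxy' : x * y' ≠ 1 := fun h => hy2 (eq_inv_of_mul_eq_one_right h)
    have e1 := psi1_mul_aux x (x * y') hx hxy'
    have e2 := psi1_mul_aux x⁻¹ y' (inv_ne_one.mpr hx) hy1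
    rw [show x * y' * x⁻¹ = y' by rw [mul_comm x, mul_inv_cancel_right]] at e1
    rw [inv_inv, sq_inv, mul_comm y' x] at e2
    have hy : y = x⁻¹ := eq_inv_of_mul_eq_one_right hxy
    rw [hxy, psi1_one, hy]
    have e3 := congrArg (fun t => sq x • t) e2
    simp only [smul_add, smul_smul, sq_mul_self, one_smul] at e3
    rw [e3] at e1
    have e4 : psi1 x + sq x • psi1 x⁻¹ + psi1 (x * y') = psi1 (x * y') := by
      rw [add_assoc]; exact e1.symm
    exact (left_eq_add.mp (by rw [add_comm]; exact e4.symm)).symm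
  · have := psi1_mul_aux x (x * y) hx hxy
    rwa [show x * y * x⁻¹ = y by rw [mul_comm x, mul_inv_cancel_right]] at this

/-- `C(x)` does not depend on `x`. -/
theorem constC_eq (h2 : Nat.card F ≠ 2) (h3 : Nat.card F ≠ 3) (x y : Fˣ) (hx : x ≠ 1)
    (hy : y ≠ 1) : constC x hx = constC y hy := by
  have h1 := five_term' x y hx hy
  have h4 := five_term' (oneSub x hx) (oneSub y hy) (oneSub_ne_one x hx) (oneSub_ne_one y hy)
  rw [oneSub_oneSub, oneSub_oneSub] at h4
  unfold constC
  set u := oneSub x hx with hu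
  set v := oneSub y hy with hv
  have h5 := congrArg₂ (fun s t => s + sq (-1 : Fˣ) • t) h1 h4
  have p1 : psi1 y = psi1 x + sq x • psi1 (y * x⁻¹) := by
    rw [← psi1_mul h2 h3]; congr 1; simp
  have p2 : psi1 (v⁻¹ * y) = psi1 (u⁻¹ * x) + (sq u * sq x) • psi1 (u * x⁻¹ * v⁻¹ * y) := by
    rw [← sq_inv u, ← sq_mul, ← psi1_mul h2 h3]; congr 1
    ext; push_cast; field_simp
  have p3 : psi1 v⁻¹ = psi1 u⁻¹ + sq u • psi1 (u * v⁻¹) := by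
    rw [← sq_inv u, ← psi1_mul h2 h3]; congr 1; simp
  rw [psi1_mul h2 h3, psi1_mul h2 h3, sq_inv, sq_inv, p3] at p2
  have e1 : (y * x⁻¹)⁻¹ = x * y⁻¹ := by simp
  have e2 : (u * x⁻¹ * v⁻¹ * y)⁻¹ = x * u⁻¹ * y⁻¹ * v := by
    ext; push_cast; field_simp
  have e3 : (u * v⁻¹)⁻¹ = v * u⁻¹ := by simp
  have q1 : psi1 (y * x⁻¹) = gpb (y * x⁻¹) + sq (-1 : Fˣ) • gpb (x * y⁻¹) := by rw [psi1, e1]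
  have q2 : psi1 (u * x⁻¹ * v⁻¹ * y) = gpb (u * x⁻¹ * v⁻¹ * y)
      + sq (-1 : Fˣ) • gpb (x * u⁻¹ * y⁻¹ * v) := by rw [psi1, e2]
  have q3 : psi1 (u * v⁻¹) = gpb (u * v⁻¹) + sq (-1 : Fˣ) • gpb (v * u⁻¹) := by rw [psi1, e3]
  -- the sum of the two relations, written through `ψ₁`
  have h6 : (gpb x + sq (-1 : Fˣ) • gpb u) - (gpb y + sq (-1 : Fˣ) • gpb v) + sq x • psi1 (y * x⁻¹)
      - (sq u * sq x) • psi1 (u * x⁻¹ * v⁻¹ * y) + sq u • psi1 (u * v⁻¹) = 0 := by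
    rw [q1, q2, q3]
    simp only [smul_zero, add_zero] at h5
    rw [← h5]
    module
  have r1 : sq x • psi1 (y * x⁻¹) = psi1 y - psi1 x := by rw [p1]; abel
  have r3 : sq u • psi1 (u * v⁻¹) = psi1 v⁻¹ - psi1 u⁻¹ := by rw [p3]; abel
  have r2 : (sq u * sq x) • psi1 (u * x⁻¹ * v⁻¹ * y)
      = (psi1 v⁻¹ + sq v • psi1 y) - (psi1 u⁻¹ + sq u • psi1 x) := by
    rw [p3, p2]; abel
  rw [r1, r2, r3] at h6
  simp only [pf, sub_smul, one_smul]
  rw [← sub_eq_zero, ← h6]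
  abel

/-- `β_F` is the common value of the `C(x)` when `F` has at least four elements. -/
theorem bconst_eq_constC (h2 : Nat.card F ≠ 2) (h3 : Nat.card F ≠ 3) (x : Fˣ) (hx : x ≠ 1) :
    bconst F = constC x hx := by
  unfold bconst
  rw [dif_neg h2, if_neg h3]
  exact constC_eq h2 h3 _ _ _ _

end

end RefinedBloch

/-! Let |F| ≥ 4. Constancy of C on the orbit of x under z ↦ 1/z and z ↦ 1 - z gives ⟨-1⟩β = β and 3β
= ψ₁(-1) (`three_smul_bconst`). The cocycle identity makes ψ₁(-1) 2-torsion, so 3D = 0.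

The coboundary formula (`pf_smul_two_bconst`) comes from the five term relations at (x, y) and (1/x,
y/x), weighted so that [y] and [y/x] cancel. The four quotient symbols pair up as [z] +
⟨-1⟩[z/(z-1)] = 2β + ψ₁(1/(1-z)); the two pairs carry weights differing by ⟨x⟩, which leaves
⟨⟨x⟩⟩2β.

For norms, the coboundary formula at x and at 1 - x evaluates (1 - ⟨z⟩⟨1-z⟩)[z]
(`one_sub_smul_gpb`). Put n = x² - x + 1. The five term relation at (x, 1 - 1/x), and its analogue
for x/(x-1), express -D through the same three symbols [z] with different weights
(`orbit_relation`), and each 1 - z is n times a square. Subtracting the first from ⟨n⟩ times the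
second makes that evaluation applicable to every symbol; the right-hand sides cancel and ⟨⟨n⟩⟩D = 0
remains. Scaling by squares extends this to a² - ab + b², the norm form of E/F when T² + T + 1 is
irreducible. If it has a root and 3 ≠ 0, the form represents everything; in characteristic 3, D = 0.
Since ⟨-1⟩D = D, the sign of x is harmless. -/

namespace RefinedBloch

noncomputable section

section GroupRingIdentities

/-! Linear algebra over a commutative ring with elements `a`, `b`, `m` of square one; in the
applications these are the classes `⟨x⟩`, `⟨1 - x⟩`, `⟨-1⟩`. -/

variable {R M : Type*} [CommRing R] [AddCommGroup M] [Module R M] {a b m : R}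

theorem negOne_smul_const_of_symm (ha : a * a = 1) (hm : m * m = 1) {B X Y p q : M}
    (h1 : B = X + m • Y + (b - 1) • p) (h1' : B = Y + m • X + (a - 1) • q)
    (hp : m • p = -(a • p)) (hpq : (a - 1) • q = (b - 1) • p) : m • B = B := by
  linear_combination (norm := module) (m : R) • h1
    + (-1 : R) • h1'
    + (-1 + b : R) • hp
    + (a : R) • hpq
    + ((1) * hm) • Y
    + ((-1) * ha) • q

/-- With weights 1, m, 1 the symbols X, Y, Z of the three instances of C cancel, and only values of
ψ₁ survive. -/
theorem three_smul_const_of_orbit (ha : a * a = 1) (hb : b * b = 1) (hm : m * m = 1)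
    {B X Y Z p q r s : M} (h1 : B = X + m • Y + (b - 1) • p)
    (h2 : B = m • (p - X) + m • Z + (m * a * b - 1) • (m • p))
    (h3 : B = m • (q - Y) + (r - Z) + (m * a * b - 1) • (m • q))
    (hB : m • B = B) (hr : r = s + m • q + b • p)
    (hp : m • p = -(a • p)) (hq : m • q = -(b • q)) (hpq : (a - 1) • q = (b - 1) • p) :
    (3 : R) • B = s := by
  linear_combination (norm := module) h1
    + (m : R) • h2
    + h3
    + (-1 : R) • hB
    + hr
    + (a * b : R) • hp
    + hq
    + (b : R) • hpq
    + ((-1) * hm) • X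
    + ((-b) * ha) • p
    + ((1) * hb) • p
    + ((a * b * m) * hm) • p
    + ((1) * hm) • Z
    + ((a * b) * hm) • q

theorem orbit_sub_of_const (ha : a * a = 1) (hm : m * m = 1) {B X Z p : M}
    (h2 : B = m • (p - X) + m • Z + (m * a * b - 1) • (m • p))
    (hB : m • B = B) (hp : m • p = -(a • p)) : Z - X = b • p + B := by
  linear_combination (norm := module) (-m : R) • h2
    + hB
    + (-a * b : R) • hp
    + ((-1) * hm) • Z
    + ((1) * hm) • X
    + ((b) * ha) • p
    + ((-a * b * m) * hm) • p

/-- The hypothesis `hrr` says (1 + ab)r = 0, while r = s - b(q - p). -/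
theorem antisymm_of_orbit (hb : b * b = 1) (hm : m * m = 1) {p q r s : M}
    (hrr : m • r = -((m * a * b) • r)) (hr : r = s + m • q + b • p) (hq : m • q = -(b • q)) :
    (a + b) • (q - p) = (1 + a * b) • s := by
  linear_combination (norm := module) (-m : R) • hrr
    + (1 + a * b : R) • hr
    + (1 + a * b : R) • hq
    + ((-a) * hb) • q
    + ((a) * hb) • p
    + ((1 + a * b) * hm) • r

/-- `hD` and `hD'` are the coboundary formula at x and at 1 - x; `h1` eliminates Y = [1 - x] between
them. -/
theorem one_sub_smul_of_relations (ha : a * a = 1) (hb : b * b = 1) (hm : m * m = 1)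
    {B D X Y p q s : M} (h1 : B = X + m • Y + (b - 1) • p)
    (hD : (a - 1) • D = p - b • (a • X + m • (p - X)))
    (hD' : (b - 1) • D = q - a • (b • Y + m • (q - Y)))
    (hB : B = s - D) (hDm : m • D = D) (h3D : (3 : R) • D = 0)
    (hsm : m • s = s) (hs : (2 : R) • s = 0)
    (hp : m • p = -(a • p)) (hq : m • q = -(b • q)) (hpq : (a - 1) • q = (b - 1) • p)
    (han : (a + b) • (q - p) = (1 + a * b) • s) (hsp : (a - 1) • s = (m - 1) • p) :
    (1 - a * b) • X = ((1 - a) * (1 + b)) • D + (a - 1) • s := by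
  linear_combination (norm := module) (-1 : R) • hD
    + (b * m - m * m : R) • h1
    + (a : R) • hD'
    + (-b * m + m * m : R) • hB
    + (b : R) • hDm
    + (-1 + a : R) • h3D
    + (-b : R) • hsm
    + hs
    + hp
    + (-1 : R) • hq
    + han
    + (-1 + b : R) • hsp
    + (-1 + b : R) • hp
    + (1 + a : R) • hpq
    + ((-1) * hm) • X
    + ((-1) * hm) • D
    + ((1) * hm) • s
    + ((m) * hb) • p
    + ((1 - b) * hm) • p
    + ((-b + m) * ha) • Y
    + ((b - m) * hm) • Y
    + ((-1 - m) * ha) • q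

/-- In n·`h2` - `h1` the coefficients of U, V, W are -a(1 - mbn), -b(1 - abn), -mab(1 - man), so
`k1`, `k2`, `k3` apply. Their right-hand sides cancel because a(1 - mb) + b(1 - ab) + mab(1 - ma) =
0. -/
theorem sub_one_smul_eq_zero_of_orbits {n : R} (ha : a * a = 1) (hb : b * b = 1) (hm : m * m = 1)
    {D U V W s : M} (h1 : a • U + b • V + (m * a * b) • W = -D)
    (h2 : (m * a * b) • U + a • V + b • W = -D)
    (k1 : (1 - m * b * n) • U = ((1 - m * b) * (1 + n)) • D + (m * b - 1) • s)
    (k2 : (1 - a * b * n) • V = ((1 - a * b) * (1 + n)) • D + (a * b - 1) • s)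
    (k3 : (1 - m * a * n) • W = ((1 - m * a) * (1 + n)) • D + (m * a - 1) • s) :
    (n - 1) • D = 0 := by
  linear_combination (norm := module) (-1 : R) • h1
    + (n : R) • h2
    + (a : R) • k1
    + (b : R) • k2
    + (a * b * m : R) • k3
    + ((a * n) * hb) • V
    + ((b * m * m * n) * ha) • W
    + ((b * n) * hm) • W
    + ((-b * m * m - b * m * m * n) * ha) • D
    + ((-a - a * n) * hb) • D
    + ((-b - b * n) * hm) • D
    + ((b * m * m) * ha) • s
    + ((a) * hb) • s
    + ((b) * hm) • s

end GroupRingIdentities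

variable {F : Type*} [Field F]

/-! Relations among the symbols. -/

theorem ne_one_of_val_eq_one_sub {x u : Fˣ} (hu : (u : F) = 1 - x) : x ≠ 1 := by
  rintro rfl
  exact u.ne_zero (by simp at hu)

theorem oneSub_eq {x u : Fˣ} (hx : x ≠ 1) (hu : (u : F) = 1 - x) : oneSub x hx = u :=
  Units.ext hu.symm

theorem five_term_of_val {x y u v : Fˣ} (hu : (u : F) = 1 - x) (hv : (v : F) = 1 - y) :
    gpb x - gpb y + sq x • gpb (y * x⁻¹) - (sq u * sq x) • gpb (u * x⁻¹ * v⁻¹ * y)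
      + sq u • gpb (u * v⁻¹) = 0 := by
  have h := five_term' x y (ne_one_of_val_eq_one_sub hu) (ne_one_of_val_eq_one_sub hv)
  rwa [oneSub_eq _ hu, oneSub_eq _ hv] at h

theorem gpb_inv (x : Fˣ) : gpb x⁻¹ = sq (-1 : Fˣ) • (psi1 x - gpb x) := by
  rw [psi1, add_sub_cancel_left, smul_smul, sq_mul_self, one_smul]

theorem psi1_inv (x : Fˣ) : psi1 x⁻¹ = sq (-1 : Fˣ) • psi1 x := by
  simp only [psi1, inv_inv, smul_add, smul_smul, sq_mul_self, one_smul]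
  rw [add_comm]

theorem negOne_smul_psi1_negOne : sq (-1 : Fˣ) • psi1 (-1 : Fˣ) = psi1 (-1) := by
  rw [← psi1_inv, inv_neg_one]

theorem sq_eq_of_mul_sq {x y t : Fˣ} (h : x = y * (t * t)) : sq x = sq y := by
  rw [h, sq_mul, sq_mul, sq_mul_self, mul_one]

end

end RefinedBloch

/-! ### The constant β on cross-ratio orbits, and the coboundary formula. -/

namespace RefinedBloch

noncomputable section

section CocycleIdentities

variable {R M : Type*} [CommRing R] [AddCommGroup M] [Module R M] {a b m : R}

theorem const_smul_eq_of_five_terms (ha : a * a = 1) (hb : b * b = 1)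
    {B E V V' W W' X X' Y p t : M}
    (h1 : X - Y + a • E - (b * a) • V + b • V' = 0)
    (h2 : X' - E + a • Y - (m * (b * a) * a) • W + (m * (b * a)) • W' = 0)
    (g1 : V + m • W = (2 : R) • B + (p + a • t)) (g2 : V' + m • W' = (2 : R) • B + t) :
    (a - 1) • ((2 : R) • B) = p - b • (a • X + X') := by
  linear_combination (norm := module) (a * b : R) • h1
    + (b : R) • h2
    + g1
    + (-a : R) • g2
    + ((-b) * ha) • E
    + ((b * b) * ha) • V
    + ((1) * hb) • V
    + ((-a) * hb) • V'
    + ((b * b * m) * ha) • W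
    + ((m) * hb) • W
    + ((-a * m) * hb) • W'

theorem smul_eq_of_quotient_by_square (ha : a * a = 1) (hb : b * b = 1) (hm : m * m = 1)
    {p q s t : M} (ht : t = s + m • (p + a • (m • q + b • (m • q))))
    (hs : (2 : R) • s = 0) (hsm : m • s = s) (hp : m • p = -(a • p)) (hq : m • q = -(b • q))
    (hsp : (a - 1) • s = (m - 1) • p) (hsq : (b - 1) • s = (m - 1) • q) :
    (m * a * b) • t = s - b • p := by
  linear_combination (norm := module) (a * b * m : R) • ht
    + (a * b : R) • hsm
    + (b : R) • hq
    + (b : R) • hsp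
    + (b : R) • hp
    + (-1 + b : R) • hs
    + (-1 : R) • hsq
    + ((a * b) * hm) • p
    + ((b * m * m * m + b * b * m * m * m) * ha) • q
    + ((-1 + m * m * m) * hb) • q
    + ((b * m + m) * hm) • q

end CocycleIdentities

variable {F : Type*} [Field F]

theorem negOne_smul_psi1 (h2 : Nat.card F ≠ 2) (h3 : Nat.card F ≠ 3) (x : Fˣ) :
    sq (-1 : Fˣ) • psi1 x = -(sq x • psi1 x) := by
  have h := psi1_mul h2 h3 x x⁻¹
  rw [mul_inv_cancel, psi1_one, psi1_inv] at h
  linear_combination (norm := module) (-sq x) • h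
    + (-sq (-1 : Fˣ) * sq_mul_self x) • psi1 x

theorem two_smul_psi1_negOne (h2 : Nat.card F ≠ 2) (h3 : Nat.card F ≠ 3) :
    (2 : SqRing F) • psi1 (-1 : Fˣ) = 0 := by
  have h := negOne_smul_psi1 h2 h3 (-1 : Fˣ)
  rw [negOne_smul_psi1_negOne] at h
  linear_combination (norm := module) h

theorem pf_smul_psi1_comm (h2 : Nat.card F ≠ 2) (h3 : Nat.card F ≠ 3) (x y : Fˣ) :
    (sq x - 1) • psi1 y = (sq y - 1) • psi1 x := by
  have h := psi1_mul h2 h3 x y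
  rw [mul_comm, psi1_mul h2 h3] at h
  linear_combination (norm := module) -h

theorem bconst_eq (h2 : Nat.card F ≠ 2) (h3 : Nat.card F ≠ 3) {x u : Fˣ}
    (hu : (u : F) = 1 - x) :
    bconst F = gpb x + sq (-1 : Fˣ) • gpb u + (sq u - 1) • psi1 x := by
  rw [bconst_eq_constC h2 h3 x (ne_one_of_val_eq_one_sub hu), constC, oneSub_eq _ hu, pf]

/-- The unit `1 - x⁻¹`, expressed through `u = 1 - x`. -/
theorem val_one_sub_inv {x u : Fˣ} (hu : (u : F) = 1 - x) :
    ((-1 * (u * x⁻¹) : Fˣ) : F) = 1 - ((x⁻¹ : Fˣ) : F) := by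
  push_cast
  field_simp
  rw [hu]; ring

theorem val_one_sub_symm {x u : Fˣ} (hu : (u : F) = 1 - x) : (x : F) = 1 - u := by
  rw [hu]; ring

theorem psi1_one_sub_inv (h2 : Nat.card F ≠ 2) (h3 : Nat.card F ≠ 3) (x u : Fˣ) :
    psi1 (-1 * (u * x⁻¹))
      = psi1 (-1) + sq (-1 : Fˣ) • psi1 u + sq u • psi1 x := by
  rw [psi1_mul h2 h3, psi1_mul h2 h3, psi1_inv]
  linear_combination (norm := module) (sq u * sq_mul_self (-1 : Fˣ)) • psi1 x

theorem bconst_eq_inv (h2 : Nat.card F ≠ 2) (h3 : Nat.card F ≠ 3) {x u : Fˣ}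
    (hu : (u : F) = 1 - x) :
    bconst F = sq (-1 : Fˣ) • (psi1 x - gpb x) + sq (-1 : Fˣ) • gpb (-1 * (u * x⁻¹))
      + (sq (-1 : Fˣ) * sq x * sq u - 1) • (sq (-1 : Fˣ) • psi1 x) := by
  rw [bconst_eq h2 h3 (val_one_sub_inv hu), gpb_inv, psi1_inv, sq_mul, sq_mul, sq_inv,
    mul_comm (sq u), mul_assoc]

/-- The orbit closes up: 1 - (1 - x)⁻¹ is the inverse of 1 - x⁻¹, so no new symbol appears. -/
theorem bconst_eq_oneSub_inv (h2 : Nat.card F ≠ 2) (h3 : Nat.card F ≠ 3) {x u : Fˣ}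
    (hu : (u : F) = 1 - x) :
    bconst F = sq (-1 : Fˣ) • (psi1 u - gpb u)
      + (psi1 (-1 * (u * x⁻¹)) - gpb (-1 * (u * x⁻¹)))
      + (sq (-1 : Fˣ) * sq x * sq u - 1) • (sq (-1 : Fˣ) • psi1 u) := by
  have h := bconst_eq_inv h2 h3 (val_one_sub_symm hu)
  have e : -1 * (x * u⁻¹) = (-1 * (u * x⁻¹))⁻¹ := by
    rw [mul_inv, mul_inv, inv_inv, inv_neg_one, mul_comm x]
  rw [e, gpb_inv, smul_smul, sq_mul_self, one_smul] at h
  rw [h]; congr 3; ring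

theorem negOne_smul_bconst (h2 : Nat.card F ≠ 2) (h3 : Nat.card F ≠ 3) :
    sq (-1 : Fˣ) • bconst F = bconst F := by
  obtain ⟨x, hx⟩ := exists_unit_ne_one h2
  have hu : ((oneSub x hx : Fˣ) : F) = 1 - x := rfl
  exact negOne_smul_const_of_symm (sq_mul_self x) (sq_mul_self _) (bconst_eq h2 h3 hu)
    (bconst_eq h2 h3 (val_one_sub_symm hu)) (negOne_smul_psi1 h2 h3 x)
    (pf_smul_psi1_comm h2 h3 _ _)

theorem three_smul_bconst (h2 : Nat.card F ≠ 2) (h3 : Nat.card F ≠ 3) :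
    (3 : SqRing F) • bconst F = psi1 (-1) := by
  obtain ⟨x, hx⟩ := exists_unit_ne_one h2
  have hu : ((oneSub x hx : Fˣ) : F) = 1 - x := rfl
  exact three_smul_const_of_orbit (sq_mul_self x) (sq_mul_self _) (sq_mul_self _)
    (bconst_eq h2 h3 hu) (bconst_eq_inv h2 h3 hu) (bconst_eq_oneSub_inv h2 h3 hu)
    (negOne_smul_bconst h2 h3) (psi1_one_sub_inv h2 h3 x _) (negOne_smul_psi1 h2 h3 x)
    (negOne_smul_psi1 h2 h3 _) (pf_smul_psi1_comm h2 h3 _ _)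

theorem gpb_one_sub_inv_sub (h2 : Nat.card F ≠ 2) (h3 : Nat.card F ≠ 3) {x u : Fˣ}
    (hu : (u : F) = 1 - x) :
    gpb (-1 * (u * x⁻¹)) - gpb x = sq u • psi1 x + bconst F :=
  orbit_sub_of_const (sq_mul_self x) (sq_mul_self _) (bconst_eq_inv h2 h3 hu)
    (negOne_smul_bconst h2 h3) (negOne_smul_psi1 h2 h3 x)

/-- The second argument is x/(x-1). This evaluates the pairs of symbols left over in
`pf_smul_two_bconst`. -/
theorem gpb_add_gpb_div_sub_one (h2 : Nat.card F ≠ 2) (h3 : Nat.card F ≠ 3) {x u : Fˣ}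
    (hu : (u : F) = 1 - x) :
    gpb x + sq (-1 : Fˣ) • gpb (-1 * (x * u⁻¹))
      = (2 : SqRing F) • bconst F + psi1 u⁻¹ := by
  have e : -1 * (x * u⁻¹) = (-1 * (u * x⁻¹))⁻¹ := by
    rw [mul_inv, mul_inv, inv_inv, inv_neg_one, mul_comm x]
  rw [e, gpb_inv, smul_smul, sq_mul_self, one_smul, psi1_inv, psi1_one_sub_inv h2 h3]
  linear_combination (norm := module) (-1 : SqRing F) • gpb_one_sub_inv_sub h2 h3 hu
    - three_smul_bconst h2 h3

/-- The coboundary formula for `ψ₁ - ψ₂`. -/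
theorem pf_smul_two_bconst (h2 : Nat.card F ≠ 2) (h3 : Nat.card F ≠ 3) {x u : Fˣ}
    (hu : (u : F) = 1 - x) :
    (sq x - 1) • ((2 : SqRing F) • bconst F)
      = psi1 x - sq u • (sq x • gpb x + gpb x⁻¹) := by
  obtain ⟨y, hy1, hyx⟩ := exists_third h3 x (ne_one_of_val_eq_one_sub hu)
  obtain ⟨w, hw⟩ : ∃ w : Fˣ, (w : F) = 1 - y := ⟨oneSub y hy1, rfl⟩
  obtain ⟨d, hd⟩ : ∃ d : Fˣ, (d : F) = y - x :=
    ⟨Units.mk0 _ (sub_ne_zero.mpr fun h => hyx (Units.ext h)), rfl⟩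
  have f1 := five_term_of_val hu hw
  have hyd : ((-1 * (d * x⁻¹) : Fˣ) : F) = 1 - ((y * x⁻¹ : Fˣ) : F) := by
    push_cast
    field_simp
    rw [hd]; ring
  have f2 := five_term_of_val (val_one_sub_inv hu) hyd
  -- For both quotient symbols [z] of `f1`, the partner [z/(z-1)] is a quotient symbol of `f2`.
  have hv1 : ((-1 * (d * (x * w)⁻¹) : Fˣ) : F) = 1 - ((u * x⁻¹ * w⁻¹ * y : Fˣ) : F) := by
    push_cast
    field_simp
    rw [hd, hu, hw]; ring
  have hv2 : ((-1 * (d * w⁻¹) : Fˣ) : F) = 1 - ((u * w⁻¹ : Fˣ) : F) := by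
    push_cast
    field_simp
    rw [hd, hu, hw]; ring
  have g1 := gpb_add_gpb_div_sub_one h2 h3 hv1
  have g2 := gpb_add_gpb_div_sub_one h2 h3 hv2
  rw [show y * x⁻¹ * x⁻¹⁻¹ = y by group,
    show -1 * (u * x⁻¹) * x⁻¹⁻¹ * (-1 * (d * x⁻¹))⁻¹ * (y * x⁻¹) = u * y * d⁻¹ by
      ext; push_cast; field_simp,
    show -1 * (u * x⁻¹) * (-1 * (d * x⁻¹))⁻¹ = u * d⁻¹ by
      ext; push_cast; field_simp,
    sq_mul, sq_mul, sq_inv] at f2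
  rw [show -1 * (u * x⁻¹ * w⁻¹ * y * (-1 * (d * (x * w)⁻¹))⁻¹) = u * y * d⁻¹ by
      ext; push_cast; field_simp,
    show (-1 * (d * (x * w)⁻¹))⁻¹ = x * (-1 * (w * d⁻¹)) by
      ext; push_cast; field_simp,
    psi1_mul h2 h3 x] at g1
  rw [show -1 * (u * w⁻¹ * (-1 * (d * w⁻¹))⁻¹) = u * d⁻¹ by
      ext; push_cast; field_simp,
    show (-1 * (d * w⁻¹))⁻¹ = -1 * (w * d⁻¹) by
      ext; push_cast; field_simp] at g2
  exact const_smul_eq_of_five_terms (sq_mul_self x) (sq_mul_self u) f1 f2 g1 g2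

end

end RefinedBloch

/-! ### Annihilation of D by the values of the form a² - ab + b². -/

namespace RefinedBloch

noncomputable section

variable {F : Type*} [Field F]

theorem dconst_eq : dconst F = (2 : SqRing F) • bconst F := by
  rw [dconst, two_smul, two_smul]

theorem negOne_smul_dconst (h2 : Nat.card F ≠ 2) (h3 : Nat.card F ≠ 3) :
    sq (-1 : Fˣ) • dconst F = dconst F := by
  rw [dconst_eq, smul_comm, negOne_smul_bconst h2 h3]

theorem three_smul_dconst (h2 : Nat.card F ≠ 2) (h3 : Nat.card F ≠ 3) :
    (3 : SqRing F) • dconst F = 0 := by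
  rw [dconst_eq, smul_comm, three_smul_bconst h2 h3, two_smul_psi1_negOne h2 h3]

theorem pf_smul_dconst (h2 : Nat.card F ≠ 2) (h3 : Nat.card F ≠ 3) (x : Fˣ) :
    pf x • dconst F = psi1 x - psi2 x := by
  by_cases hx : x = 1
  · simp [hx, pf, sq_one, psi1_one, psi2]
  · rw [psi2, dif_neg hx, pf, dconst_eq]
    exact pf_smul_two_bconst h2 h3 rfl

theorem pf_smul_dconst_of_val (h2 : Nat.card F ≠ 2) (h3 : Nat.card F ≠ 3) {x u : Fˣ}
    (hu : (u : F) = 1 - x) :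
    (sq x - 1) • dconst F
      = psi1 x - sq u • (sq x • gpb x + sq (-1 : Fˣ) • (psi1 x - gpb x)) := by
  rw [dconst_eq, pf_smul_two_bconst h2 h3 hu, gpb_inv]

/-- The defect of invariance of `[x]` under a Klein four symmetry of the cross ratio. -/
theorem one_sub_smul_gpb (h2 : Nat.card F ≠ 2) (h3 : Nat.card F ≠ 3) {x u : Fˣ}
    (hu : (u : F) = 1 - x) :
    (1 - sq x * sq u) • gpb x
      = ((1 - sq x) * (1 + sq u)) • dconst F + (sq x - 1) • psi1 (-1 : Fˣ) := by
  have hrr := negOne_smul_psi1 h2 h3 (-1 * (u * x⁻¹))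
  rw [sq_mul (-1), sq_mul, sq_inv, mul_comm (sq u),
    ← mul_assoc (sq (-1 : Fˣ))] at hrr
  have hr := psi1_one_sub_inv h2 h3 x u
  have hq := negOne_smul_psi1 h2 h3 u
  have han := antisymm_of_orbit (sq_mul_self u) (sq_mul_self (-1)) hrr hr hq
  have hB : bconst F = psi1 (-1) - dconst F := by
    rw [← three_smul_bconst h2 h3, dconst_eq]
    module
  exact one_sub_smul_of_relations (sq_mul_self x) (sq_mul_self u) (sq_mul_self (-1))
    (bconst_eq h2 h3 hu) (pf_smul_dconst_of_val h2 h3 hu)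
    (pf_smul_dconst_of_val h2 h3 (val_one_sub_symm hu)) hB (negOne_smul_dconst h2 h3)
    (three_smul_dconst h2 h3) negOne_smul_psi1_negOne (two_smul_psi1_negOne h2 h3)
    (negOne_smul_psi1 h2 h3 x) hq (pf_smul_psi1_comm h2 h3 x u) han
    (pf_smul_psi1_comm h2 h3 x (-1))

/-- The five term relation for two orbits of an element of order three acting on the line. -/
theorem orbit_relation (h2 : Nat.card F ≠ 2) (h3 : Nat.card F ≠ 3) {x u : Fˣ}
    (hu : (u : F) = 1 - x) :
    sq x • gpb (-1 * (u * (x⁻¹ * x⁻¹))) + sq u • gpb (x * u)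
      + (sq (-1 : Fˣ) * sq x * sq u) • gpb (-1 * (x * (u⁻¹ * u⁻¹))) = -dconst F := by
  have hx' : ((x⁻¹ : Fˣ) : F) = 1 - ((-1 * (u * x⁻¹) : Fˣ) : F) :=
    val_one_sub_symm (val_one_sub_inv hu)
  have f := five_term_of_val hu hx'
  rw [show -1 * (u * x⁻¹) * x⁻¹ = -1 * (u * (x⁻¹ * x⁻¹)) by
      ext; push_cast; field_simp,
    show u * x⁻¹ * x⁻¹⁻¹ * (-1 * (u * x⁻¹)) = (-1 * (x * (u⁻¹ * u⁻¹)))⁻¹ by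
      ext; push_cast; field_simp,
    show u * x⁻¹⁻¹ = x * u by rw [inv_inv, mul_comm], gpb_inv] at f
  have ht : psi1 (-1 * (x * (u⁻¹ * u⁻¹))) = psi1 (-1) + sq (-1 : Fˣ) • (psi1 x
      + sq x • (sq (-1 : Fˣ) • psi1 u + sq u • (sq (-1 : Fˣ) • psi1 u))) := by
    rw [psi1_mul h2 h3, psi1_mul h2 h3, psi1_mul h2 h3, psi1_inv, sq_inv]
  have e := smul_eq_of_quotient_by_square (sq_mul_self x) (sq_mul_self u) (sq_mul_self (-1)) ht
    (two_smul_psi1_negOne h2 h3) negOne_smul_psi1_negOne (negOne_smul_psi1 h2 h3 x)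
    (negOne_smul_psi1 h2 h3 u) (pf_smul_psi1_comm h2 h3 x (-1)) (pf_smul_psi1_comm h2 h3 u (-1))
  have hs := two_smul_psi1_negOne (F := F) h2 h3
  have h3B := three_smul_bconst (F := F) h2 h3
  have hZ := gpb_one_sub_inv_sub h2 h3 hu
  rw [dconst_eq]
  -- The ψ₁(x) terms cancel, leaving β + ψ₁(-1) = 4β, which is -2β because 6β = 0.
  linear_combination (norm := module) f + hZ + e + h3B + hs

theorem sub_one_smul_dconst_of_quadratic (h2 : Nat.card F ≠ 2) (h3 : Nat.card F ≠ 3) {n : Fˣ}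
    {t : F} (hn : (n : F) = t ^ 2 - t + 1) : (sq n - 1) • dconst F = 0 := by
  by_cases ht0 : t = 0
  · have : n = 1 := Units.ext (by simp [hn, ht0])
    rw [this, sq_one, sub_self, zero_smul]
  by_cases ht1 : t = 1
  · have : n = 1 := Units.ext (by simp [hn, ht1])
    rw [this, sq_one, sub_self, zero_smul]
  obtain ⟨x, hx⟩ : ∃ x : Fˣ, (x : F) = t := ⟨Units.mk0 t ht0, rfl⟩
  obtain ⟨u, hu⟩ : ∃ u : Fˣ, (u : F) = 1 - x :=
    ⟨Units.mk0 (1 - x) (sub_ne_zero.mpr fun h => ht1 (by rw [← hx, ← h])), rfl⟩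
  rw [← hx] at hn
  -- Passing from x to x/(x-1) reproduces the same three symbols with different weights.
  have huv : ((u⁻¹ : Fˣ) : F) = 1 - ((-1 * (x * u⁻¹) : Fˣ) : F) :=
    val_one_sub_symm (val_one_sub_inv (val_one_sub_symm hu))
  have r1 := orbit_relation h2 h3 hu
  have r2 := orbit_relation h2 h3 huv
  rw [show -1 * (u⁻¹ * ((-1 * (x * u⁻¹))⁻¹ * (-1 * (x * u⁻¹))⁻¹)) = -1 * (u * (x⁻¹ * x⁻¹)) by
      ext; push_cast; field_simp,
    show -1 * (x * u⁻¹) * u⁻¹ = -1 * (x * (u⁻¹ * u⁻¹)) by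
      ext; push_cast; field_simp,
    show -1 * (-1 * (x * u⁻¹) * (u⁻¹⁻¹ * u⁻¹⁻¹)) = x * u by
      ext; push_cast; field_simp,
    sq_mul, sq_mul, sq_inv] at r2
  have v1 : ((n * (x⁻¹ * x⁻¹) : Fˣ) : F) = 1 - ((-1 * (u * (x⁻¹ * x⁻¹)) : Fˣ) : F) := by
    push_cast
    field_simp
    rw [hn, hu]; ring
  have v2 : (n : F) = 1 - ((x * u : Fˣ) : F) := by
    push_cast
    rw [hn, hu]; ring
  have v3 : ((n * (u⁻¹ * u⁻¹) : Fˣ) : F) = 1 - ((-1 * (x * (u⁻¹ * u⁻¹)) : Fˣ) : F) := by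
    push_cast
    field_simp
    rw [hn, hu]; ring
  have k1 := one_sub_smul_gpb h2 h3 v1
  have k2 := one_sub_smul_gpb h2 h3 v2
  have k3 := one_sub_smul_gpb h2 h3 v3
  have sq_mul_inv_inv : ∀ y z : Fˣ, sq (y * (z⁻¹ * z⁻¹)) = sq y := fun y z =>
    sq_eq_of_mul_sq rfl
  rw [sq_mul (-1), sq_mul_inv_inv, sq_mul_inv_inv] at k1 k3
  rw [sq_mul] at k2
  refine sub_one_smul_eq_zero_of_orbits (sq_mul_self x) (sq_mul_self u) (sq_mul_self (-1)) r1 ?_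
    k1 k2 k3
  linear_combination (norm := module) r2
    - (sq x * sq u * sq u * sq_mul_self (-1 : Fˣ) + sq x * sq_mul_self u) • gpb (x * u)

/-- In characteristic 3, -1 is a fixed point of z ↦ 1 - z, so C(-1) reduces to ⟨-1⟩ψ₁(-1), which is
2-torsion. -/
theorem dconst_eq_zero_of_three_eq_zero (h2 : Nat.card F ≠ 2) (h3 : Nat.card F ≠ 3)
    (h : (3 : F) = 0) : dconst F = 0 := by
  have hu : ((-1 : Fˣ) : F) = 1 - ((-1 : Fˣ) : F) := by
    push_cast
    linear_combination -h
  have hB := bconst_eq h2 h3 hu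
  have hs := negOne_smul_psi1_negOne (F := F)
  have e : psi1 (-1 : Fˣ) = gpb (-1) + sq (-1 : Fˣ) • gpb (-1) := by rw [psi1, inv_neg_one]
  rw [← e] at hB
  rw [dconst_eq, hB]
  linear_combination (norm := module) (2 : SqRing F) • hs + two_smul_psi1_negOne h2 h3

theorem sub_one_smul_dconst_of_norm_form (h2 : Nat.card F ≠ 2) (h3 : Nat.card F ≠ 3) {n : Fˣ}
    {a b : F} (hn : (n : F) = a ^ 2 - a * b + b ^ 2) : (sq n - 1) • dconst F = 0 := by
  by_cases hb : b = 0
  · have ha : a ≠ 0 := fun ha => n.ne_zero (by rw [hn, ha, hb]; ring)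
    rw [sq_eq_of_mul_sq (y := 1) (t := Units.mk0 a ha)
      (Units.ext (by simp [hn, hb, pow_two])), sq_one, sub_self, zero_smul]
  · have hc : (a / b) ^ 2 - a / b + 1 = n / b ^ 2 := by rw [hn]; field_simp
    have hc0 : (a / b) ^ 2 - a / b + 1 ≠ 0 := by
      rw [hc]; exact div_ne_zero n.ne_zero (pow_ne_zero 2 hb)
    rw [sq_eq_of_mul_sq (y := Units.mk0 _ hc0) (t := Units.mk0 b hb)
      (Units.ext (by simp only [Units.val_mul, Units.val_mk0]; rw [hc]; field_simp))]
    exact sub_one_smul_dconst_of_quadratic h2 h3 rfl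

theorem exists_norm_form_of_root {w : F} (hw : w ^ 2 + w + 1 = 0) (h3 : (3 : F) ≠ 0) (c : F) :
    ∃ a b : F, c = a ^ 2 - a * b + b ^ 2 := by
  have hd : 1 + 2 * w ≠ 0 := fun h => h3 (by linear_combination (4 : F) * hw - (1 + 2 * w) * h)
  -- The form splits as (a + wb)(a - (1 + w)b); the witnesses make the factors c and 1. The
  -- denominator satisfies (1 + 2w)² = -3.
  refine ⟨(c * (1 + w) + w) / (1 + 2 * w), (c - 1) / (1 + 2 * w), ?_⟩
  rw [eq_comm, div_pow, div_pow, div_mul_div_comm, ← pow_two, ← sub_div, ← add_div,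
    div_eq_iff (pow_ne_zero 2 hd)]
  linear_combination -(2 * c - c ^ 2 - 1) * hw

end

end RefinedBloch

/-! ### Norms from F(ζ₃), the field with three elements, and assembly. -/

namespace RefinedBloch

section Norm

open Polynomial Module

variable {F : Type*} [Field F]

/-- The norm form of a quadratic extension generated by a root of `T² + T + 1`. -/
theorem norm_eq_of_basis {E : Type*} [Field E] [Algebra F E] (B : Basis (Fin 2) F E) {z : E}
    (h0 : B 0 = 1) (h1 : B 1 = z) (hz : z ^ 2 + z + 1 = 0) (e : E) :
    ∃ a b : F, Algebra.norm F e = a ^ 2 - a * b + b ^ 2 := by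
  refine ⟨B.repr e 0, B.repr e 1, ?_⟩
  set a := B.repr e 0
  set b := B.repr e 1
  have he : e = a • B 0 + b • B 1 := by
    conv_lhs => rw [← B.sum_repr e, Fin.sum_univ_two]
  have c0 : e * B 0 = a • B 0 + b • B 1 := by rw [h0, mul_one, he, h0]
  have c1 : e * B 1 = (-b) • B 0 + (a - b) • B 1 := by
    rw [he, h0, h1]
    simp only [Algebra.smul_def, map_neg, map_sub]
    linear_combination (algebraMap F E b) * hz
  rw [Algebra.norm_eq_matrix_det B, Matrix.det_fin_two]
  simp only [Algebra.leftMulMatrix_eq_repr_mul, c0, c1, map_add, map_smul, Basis.repr_self,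
    Finsupp.add_apply, Finsupp.smul_apply, Finsupp.single_apply]
  simp
  ring

theorem exists_norm_form_of_no_root (h3 : (3 : F) ≠ 0) (hw : ∀ w : F, w ^ 2 + w + 1 ≠ 0)
    (e : CyclotomicField 3 F) :
    ∃ a b : F, Algebra.norm F e = a ^ 2 - a * b + b ^ 2 := by
  have : NeZero ((3 : ℕ) : F) := ⟨by exact_mod_cast h3⟩
  have : NeZero ((3 : ℕ) : CyclotomicField 3 F) := NeZero.nat_of_injective
    (algebraMap F (CyclotomicField 3 F)).injective
  have hdeg : (cyclotomic 3 F).natDegree = 2 := by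
    rw [natDegree_cyclotomic]; rfl
  have hirr : Irreducible (cyclotomic 3 F) := by
    refine irreducible_of_degree_le_three_of_not_isRoot (by rw [hdeg]; decide) fun w h => hw w ?_
    simpa [cyclotomic_three] using h
  have hζ := IsCyclotomicExtension.zeta_spec 3 F (CyclotomicField 3 F)
  set z := IsCyclotomicExtension.zeta 3 F (CyclotomicField 3 F)
  have hz : z ^ 2 + z + 1 = 0 := by
    have := hζ.isRoot_cyclotomic (by norm_num)
    simpa [cyclotomic_three] using this
  have hdim : (hζ.powerBasis F).dim = 2 := by
    rw [← (hζ.powerBasis F).finrank, IsCyclotomicExtension.finrank _ hirr]; rfl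
  refine norm_eq_of_basis ((hζ.powerBasis F).basis.reindex (finCongr hdim)) (z := z) ?_ ?_ hz e
  · simp
  · simp

end Norm

noncomputable section

variable {F : Type*} [Field F]

/-- Here the relation `three` reads 2ψ₁(-1) = 0, and 1 - (-1) = -1 identifies ψ₂(-1) with ψ₁(-1). -/
theorem psi_eq_of_card_three (h3 : Nat.card F = 3) (x : Fˣ) :
    dconst F = 0 ∧ psi1 x = psi2 x := by
  have hD : dconst F = 0 := by
    have h := (Submodule.Quotient.mk_eq_zero (relSub F)).mpr
      (Submodule.subset_span (Rel.three h3))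
    rw [dconst, bconst, dif_neg (by omega), if_pos h3, psi1, inv_neg_one]
    simpa [gpb] using h
  refine ⟨hD, ?_⟩
  by_cases hx : x = 1
  · simp [hx, psi1_one, psi2]
  have : Finite F := Nat.finite_of_card_ne_zero (by omega)
  have := Fintype.ofFinite F
  have h30 : (3 : F) = 0 := by
    have := FiniteField.cast_card_eq_zero F
    rw [← Nat.card_eq_fintype_card, h3] at this
    exact_mod_cast this
  have hxx : x = -1 := by
    have h := FiniteField.pow_card_sub_one_eq_one (x : F) x.ne_zero
    rw [← Nat.card_eq_fintype_card, h3] at h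
    rcases mul_self_eq_one_iff.mp ((pow_two (x : F)).symm.trans h) with h | h
    · exact absurd (Units.ext h) hx
    · exact Units.ext (by simpa using h)
  subst hxx
  have hu : oneSub (-1 : Fˣ) hx = -1 := Units.ext (by
    simp only [oneSub, Units.val_mk0, Units.val_neg, Units.val_one]
    linear_combination h30)
  rw [psi2, dif_neg hx, hu, psi1, inv_neg_one, smul_add, smul_smul, sq_mul_self, one_smul]

theorem pf_smul_dconst_eq_zero (h2 : Nat.card F ≠ 2) (h3 : Nat.card F ≠ 3) (x : Fˣ)
    (e : CyclotomicField 3 F)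
    (he : Algebra.norm F e = (x : F) ∨ Algebra.norm F e = -(x : F)) :
    pf x • dconst F = 0 := by
  by_cases h30 : (3 : F) = 0
  · rw [dconst_eq_zero_of_three_eq_zero h2 h3 h30, smul_zero]
  have hform : ∃ a b : F, Algebra.norm F e = a ^ 2 - a * b + b ^ 2 := by
    by_cases hw : ∃ w : F, w ^ 2 + w + 1 = 0
    · obtain ⟨w, hw⟩ := hw
      exact exists_norm_form_of_root hw h30 _
    · exact exists_norm_form_of_no_root h30 (not_exists.mp hw) e
  obtain ⟨a, b, hab⟩ := hform
  rcases he with he | he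
  · exact sub_one_smul_dconst_of_norm_form h2 h3 (he.symm.trans hab)
  · have h := sub_one_smul_dconst_of_norm_form h2 h3 (n := -1 * x) (a := a) (b := b)
      (by rw [← hab, he]; simp)
    rw [sq_mul] at h
    rw [pf]
    linear_combination (norm := module) h - sq x • negOne_smul_dconst h2 h3

end

end RefinedBloch

theorem mainTheorem3 (F : Type*) [Field F] :
    (∀ x : Fˣ, RefinedBloch.pf x • RefinedBloch.dconst F
        = RefinedBloch.psi1 x - RefinedBloch.psi2 x) ∧
    (∀ x : Fˣ,
      (∃ e : (CyclotomicField 3 F)ˣ,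
        Algebra.norm F (e : CyclotomicField 3 F) = (x : F) ∨
        Algebra.norm F (e : CyclotomicField 3 F) = -(x : F)) →
      RefinedBloch.pf x • RefinedBloch.dconst F = 0) := by
  by_cases h2 : Nat.card F = 2
  · have hx : ∀ x : Fˣ, x = 1 := by
      intro x
      have : Finite F := Nat.finite_of_card_ne_zero (by omega)
      have := Fintype.ofFinite F
      have h := FiniteField.pow_card_sub_one_eq_one (x : F) x.ne_zero
      rw [← Nat.card_eq_fintype_card, h2] at h
      exact Units.ext (by simpa using h)
    refine ⟨fun x => ?_, fun x _ => ?_⟩ <;> rw [hx x] <;>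
      simp [RefinedBloch.pf, RefinedBloch.sq_one, RefinedBloch.psi1_one, RefinedBloch.psi2]
  by_cases h3 : Nat.card F = 3
  · refine ⟨fun x => ?_, fun x _ => ?_⟩ <;>
      simp [RefinedBloch.psi_eq_of_card_three h3 x]
  · exact ⟨RefinedBloch.pf_smul_dconst h2 h3,
      fun x ⟨e, he⟩ => RefinedBloch.pf_smul_dconst_eq_zero h2 h3 x e he⟩
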